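/- Let $X$ be a complex Banach space and $B(X)$ the algebra of bounded linear operators on $X$. An operator $T\in B(X)$ is called well-bounded if there are a compact interval $[a,b]\subset\mathbb{R}$ and a constant $K$ such that $\|p(T)\|\le K\bigl(|p(b)|+\int_a^b|p'(t)|\,dt\bigr)$ for all complex polynomials $p$. Let $T\in B(X)$ be compact and well-bounded, with sum representation $T=\sum_{j=1}^\infty \mu_jP_j$ (convergence in operator norm), where $|\mu_1|\ge|\mu_2|\ge\cdots$, the nonzero $\mu_j$ are pairwise distinct eigenvalues of $T$, and, whenever $\mu_j\neq 0$, $P_j$ is the Riesz projection of $T$ at $\mu_j$, that is, $P_j=\frac1{2\pi i}\oint_{|z-\mu_j|=r}(z-T)^{-1}\,dz$ for a sufficiently small $r>0$. (If $T$ has only finitely many nonzero eigenvalues, the remaining $\mu_j$ are $0$.) Let $\pi$ be a permutation of the positive integers. If the series $\sum_{j=1}^\infty\mu_{\pi(j)}P_{\pi(j)}$ converges in operator norm, then \[ T=\sum_{j=1}^\infty \mu_{\pi(j)}P_{\pi(j)} . \] Thus a rearrangement of the sum representation cannot converge to an operator other than $T$. -/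

import Mathlib

open Filter Topology

/-- A bounded operator `T` on a complex Banach space is *well-bounded* if there are a compact
interval `[a, b]` of the real line and a constant `K` such that
`‖p(T)‖ ≤ K (|p(b)| + ∫_a^b |p'(t)| dt)` for every complex polynomial `p`. -/
def IsWellBounded {X : Type*} [NormedAddCommGroup X] [NormedSpace ℂ X] (T : X →L[ℂ] X) : Prop :=
  ∃ a b K : ℝ, a ≤ b ∧ ∀ p : Polynomial ℂ,
    ‖Polynomial.aeval T p‖ ≤
      K * (‖p.eval (b : ℂ)‖ + ∫ t in a..b, ‖p.derivative.eval (t : ℂ)‖)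

/-- `P` is the Riesz projection of `T` at the point `c`: for some `r > 0` such that the closed disc
of radius `r` about `c` contains no point of the spectrum of `T` except possibly `c`,
`P = (2πi)⁻¹ ∮_{|z - c| = r} (z - T)⁻¹ dz`.
(By Cauchy's theorem the integral does not depend on the choice of such an `r`.) -/
def IsRieszProjection {X : Type*} [NormedAddCommGroup X] [NormedSpace ℂ X]
    (T : X →L[ℂ] X) (c : ℂ) (P : X →L[ℂ] X) : Prop :=
  ∃ r : ℝ, 0 < r ∧ Metric.closedBall c r ∩ spectrum ℂ T ⊆ {c} ∧
    P = (2 * (Real.pi : ℂ) * Complex.I)⁻¹ • ∮ z in C(c, r), resolvent T z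

/-- `∑ j, μ j • P j` is a sum representation of `T`: the nonzero `μ j` are pairwise distinct
eigenvalues of `T`, `P j` is the Riesz projection of `T` at `μ j`, `|μ 0| ≥ |μ 1| ≥ ⋯`, and the
series converges to `T` in operator norm. Terms with `μ j = 0` are allowed as padding, so that
operators with only finitely many nonzero eigenvalues are included. -/
structure IsSumRepresentation {X : Type*} [NormedAddCommGroup X] [NormedSpace ℂ X]
    (T : X →L[ℂ] X) (μ : ℕ → ℂ) (P : ℕ → X →L[ℂ] X) : Prop where
  hasEigenvalue : ∀ j, μ j ≠ 0 → Module.End.HasEigenvalue (T : X →ₗ[ℂ] X) (μ j)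
  distinct : ∀ i j, μ i ≠ 0 → μ i = μ j → i = j
  isRieszProjection : ∀ j, μ j ≠ 0 → IsRieszProjection T (μ j) (P j)
  antitone_norm : Antitone fun j => ‖μ j‖
  tendsto : Tendsto (fun n => ∑ j ∈ Finset.range n, μ j • P j) atTop (𝓝 T)

/-!
Let `S` be the sum of the rearranged series and `D = T - S`.

The resolvent identity and Fubini's theorem for two disjoint contours show that the Riesz
projections `P j` with `μ j ≠ 0` are idempotents annihilating each other
(`IsRieszProjection.mul_self`, `IsRieszProjection.mul_eq_zero`). Multiplying either series by `P k`
leaves only the term `μ k • P k`, so `T`, and likewise `S`, acts on `P k` from both sides as the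
scalar `μ k` (`mul_eq_smul_of_tendsto_sum`). Hence `P k * D = 0` for all such `k`, and therefore
`T * D = 0`, whereas `D` lies in the norm closure of the linear span of the `P k`.

Well-boundedness excludes such a `D` unless it is zero. The polynomials
`p n = 1 - (1 - z ^ 2 / M ^ 2) ^ n` vanish at `0`, have total variation at most `2` on `[-M, M]`,
and tend to `1` at every `μ k ≠ 0` once `M` is large. So the operators `p n (T)` are uniformly
bounded and `p n (T) * P k = p n (μ k) • P k → P k`, which gives `p n (T) * D → D` by density. But
`p n (T) * D = p n (0) • D = 0`.
-/

/-! ### Circle integrals -/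

/-- Fubini's theorem for two circle integrals of a continuous function. -/
theorem circleIntegral_circleIntegral_swap {E : Type*} [NormedAddCommGroup E] [NormedSpace ℂ E]
    {f : ℂ → ℂ → E} {c c' : ℂ} {r r' : ℝ} (hr : 0 ≤ r) (hr' : 0 ≤ r')
    (hf : ContinuousOn (Function.uncurry f) (Metric.sphere c r ×ˢ Metric.sphere c' r')) :
    (∮ z in C(c, r), ∮ w in C(c', r'), f z w) = ∮ w in C(c', r'), ∮ z in C(c, r), f z w := by
  have hcont : Continuous (Function.uncurry fun s t : ℝ =>
      deriv (circleMap c r) s • deriv (circleMap c' r') t •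
        f (circleMap c r s) (circleMap c' r' t)) := by
    have h : Continuous fun q : ℝ × ℝ => f (circleMap c r q.1) (circleMap c' r' q.2) :=
      hf.comp_continuous (f := fun q : ℝ × ℝ => (circleMap c r q.1, circleMap c' r' q.2))
        (by fun_prop)
        fun q => ⟨circleMap_mem_sphere c hr q.1, circleMap_mem_sphere c' hr' q.2⟩
    simp only [deriv_circleMap, Function.uncurry_def]
    exact (Continuous.mul (by fun_prop) continuous_const).smul
      ((Continuous.mul (by fun_prop) continuous_const).smul h)
  have hint := (hcont.continuousOn.integrableOn_compact (μ := MeasureTheory.volume)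
    (isCompact_uIcc.prod isCompact_uIcc :
      IsCompact (Set.uIcc 0 (2 * Real.pi) ×ˢ Set.uIcc 0 (2 * Real.pi)))).mono_set
    (Set.prod_mono Set.uIoc_subset_uIcc Set.uIoc_subset_uIcc)
  simp only [circleIntegral, ← intervalIntegral.integral_smul]
  rw [MeasureTheory.intervalIntegral_intervalIntegral_swap hint]
  refine intervalIntegral.integral_congr fun t _ => intervalIntegral.integral_congr fun s _ => ?_
  exact smul_comm _ _ _

theorem circleIntegral_sub_inv_of_notMem_closedBall {c w : ℂ} {r : ℝ} (hr : 0 ≤ r)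
    (hw : w ∉ Metric.closedBall c r) : (∮ z in C(c, r), (z - w)⁻¹) = 0 := by
  have hne : ∀ z ∈ Metric.closedBall c r, z - w ≠ 0 := fun z hz h =>
    hw (sub_eq_zero.1 h ▸ hz)
  refine Complex.circleIntegral_eq_zero_of_differentiable_on_off_countable hr
    Set.countable_empty ?_ ?_
  · exact (continuousOn_id.sub continuousOn_const).inv₀ hne
  · exact fun z hz => (differentiableAt_id.sub_const w).inv
      (hne z (Metric.ball_subset_closedBall hz.1))

/-! ### Products of contour integrals of the resolvent -/

section Resolvent

variable {A : Type*} [NormedRing A] [NormedAlgebra ℂ A]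

/-- The first resolvent identity, relating the resolvents of one element at two points. -/
theorem resolvent_sub_resolvent_eq_smul_mul {a : A} {z w : ℂ} (hz : z ∈ resolventSet ℂ a)
    (hw : w ∈ resolventSet ℂ a) :
    resolvent a z - resolvent a w = (w - z) • (resolvent a z * resolvent a w) := by
  have h1 : resolvent a z * (algebraMap ℂ A z - a) = 1 := Ring.inverse_mul_cancel _ hz
  have h2 : (algebraMap ℂ A w - a) * resolvent a w = 1 := Ring.mul_inverse_cancel _ hw
  calc resolvent a z - resolvent a w
      = resolvent a z * ((algebraMap ℂ A w - a) * resolvent a w)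
        - (resolvent a z * (algebraMap ℂ A z - a)) * resolvent a w := by rw [h1, h2]; simp
    _ = resolvent a z * (algebraMap ℂ A (w - z)) * resolvent a w := by
        rw [map_sub]; noncomm_ring
    _ = (w - z) • (resolvent a z * resolvent a w) := by
        rw [Algebra.algebraMap_eq_smul_one]; simp

variable [CompleteSpace A]

theorem continuousOn_resolvent (a : A) : ContinuousOn (resolvent a) (resolventSet ℂ a) :=
  fun _ hz => (spectrum.hasDerivAt_resolvent_const_left hz).continuousAt.continuousWithinAt

theorem circleIntegral_mul_const {f : ℂ → A} {c : ℂ} {r : ℝ} (hf : CircleIntegrable f c r)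
    (b : A) : (∮ z in C(c, r), f z * b) = (∮ z in C(c, r), f z) * b := by
  have h := ContinuousLinearMap.intervalIntegral_comp_comm
    ((ContinuousLinearMap.mul ℂ A).flip b) hf.out
  simpa only [circleIntegral, ContinuousLinearMap.flip_apply, ContinuousLinearMap.mul_apply',
    smul_mul_assoc] using h

theorem circleIntegral_const_mul {f : ℂ → A} {c : ℂ} {r : ℝ} (hf : CircleIntegrable f c r)
    (b : A) : (∮ z in C(c, r), b * f z) = b * ∮ z in C(c, r), f z := by
  have h := ContinuousLinearMap.intervalIntegral_comp_comm (ContinuousLinearMap.mul ℂ A b) hf.out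
  simpa only [circleIntegral, ContinuousLinearMap.mul_apply', mul_smul_comm] using h

/-- By the resolvent identity the product of two contour integrals of the resolvent is
`∮ z, ∮ w, (w - z)⁻¹ • (resolvent a z - resolvent a w)`; swapping the integrals in the second term
reduces both to the scalar integrals of `(w - z)⁻¹`, that is, to winding numbers. The first
contour does not wind around points of the second one, so the second term vanishes; `α` is `2πi` or
`0` according to whether or not the second contour encloses the first one. -/
theorem circleIntegral_resolvent_mul_circleIntegral_resolvent {a : A} {c c' α : ℂ} {r r' : ℝ}
    (hr : 0 ≤ r) (hr' : 0 ≤ r')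
    (hres : Metric.sphere c r ⊆ resolventSet ℂ a) (hres' : Metric.sphere c' r' ⊆ resolventSet ℂ a)
    (hdisj : Disjoint (Metric.sphere c r) (Metric.sphere c' r'))
    (hα : ∀ z ∈ Metric.sphere c r, (∮ w in C(c', r'), (w - z)⁻¹) = α)
    (hzero : ∀ w ∈ Metric.sphere c' r', (∮ z in C(c, r), (z - w)⁻¹) = 0) :
    (∮ z in C(c, r), resolvent a z) * (∮ w in C(c', r'), resolvent a w) =
      α • ∮ z in C(c, r), resolvent a z := by
  have hcz : ContinuousOn (resolvent a) (Metric.sphere c r) := (continuousOn_resolvent a).mono hres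
  have hcw : ContinuousOn (resolvent a) (Metric.sphere c' r') :=
    (continuousOn_resolvent a).mono hres'
  have hne : ∀ z ∈ Metric.sphere c r, ∀ w ∈ Metric.sphere c' r', w - z ≠ 0 := fun z hz w hw h =>
    Set.disjoint_left.1 hdisj hz (sub_eq_zero.1 h ▸ hw)
  have hinv : ContinuousOn (fun q : ℂ × ℂ => (q.2 - q.1)⁻¹)
      (Metric.sphere c r ×ˢ Metric.sphere c' r') :=
    (continuousOn_snd.sub continuousOn_fst).inv₀ fun q hq => hne q.1 hq.1 q.2 hq.2
  have hpair : ∀ z ∈ Metric.sphere c r,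
      ContinuousOn (fun w : ℂ => (z, w)) (Metric.sphere c' r') := fun z _ => by fun_prop
  have hsplit : ∀ z ∈ Metric.sphere c r, resolvent a z * (∮ w in C(c', r'), resolvent a w) =
      α • resolvent a z - ∮ w in C(c', r'), (w - z)⁻¹ • resolvent a w := by
    intro z hz
    have hi : ContinuousOn (fun w => (w - z)⁻¹) (Metric.sphere c' r') :=
      hinv.comp (hpair z hz) fun w hw => ⟨hz, hw⟩
    have h1 : CircleIntegrable (fun w => (w - z)⁻¹ • resolvent a z) c' r' :=
      (hi.smul continuousOn_const).circleIntegrable hr'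
    have h2 : CircleIntegrable (fun w => (w - z)⁻¹ • resolvent a w) c' r' :=
      (hi.smul hcw).circleIntegrable hr'
    rw [← circleIntegral_const_mul (hcw.circleIntegrable hr'), ← hα z hz,
      ← circleIntegral.integral_smul_const, ← circleIntegral.integral_sub h1 h2]
    refine circleIntegral.integral_congr hr' fun w hw => ?_
    rw [← smul_sub, resolvent_sub_resolvent_eq_smul_mul (hres hz) (hres' hw),
      inv_smul_smul₀ (hne z hz w hw)]
  have hF : ContinuousOn (Function.uncurry fun z w : ℂ => (w - z)⁻¹ • resolvent a w)
      (Metric.sphere c r ×ˢ Metric.sphere c' r') :=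
    hinv.smul (hcw.comp continuousOn_snd fun q hq => hq.2)
  have hI : (∮ z in C(c, r), ∮ w in C(c', r'), (w - z)⁻¹ • resolvent a w) = 0 := by
    rw [circleIntegral_circleIntegral_swap hr hr' hF]
    have : ∀ w ∈ Metric.sphere c' r', (∮ z in C(c, r), (w - z)⁻¹ • resolvent a w) = 0 := by
      intro w hw
      have h0 : (∮ z in C(c, r), (w - z)⁻¹) = -∮ z in C(c, r), (z - w)⁻¹ := by
        rw [← neg_one_smul ℂ, ← circleIntegral.integral_smul]
        congr 1; funext z; rw [← neg_sub z w, inv_neg]; simp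
      rw [circleIntegral.integral_smul_const, h0, hzero w hw, neg_zero, zero_smul]
    rw [circleIntegral.integral_congr (g := fun _ => (0 : A)) hr' this]
    simp [circleIntegral]
  have hint : CircleIntegrable (fun z => α • resolvent a z) c r :=
    (hcz.const_smul α).circleIntegrable hr
  -- By `hsplit` the inner integral is a difference of functions of `z` known to be continuous.
  have hint' : CircleIntegrable (fun z => ∮ w in C(c', r'), (w - z)⁻¹ • resolvent a w) c r := by
    refine ContinuousOn.circleIntegrable hr (((hcz.const_smul α).sub
      (hcz.mul (continuousOn_const (c := ∮ w in C(c', r'), resolvent a w)))).congr fun z hz => ?_)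
    exact (sub_sub_cancel _ _).symm.trans (congrArg (α • resolvent a z - ·) (hsplit z hz).symm)
  rw [← circleIntegral_mul_const (hcz.circleIntegrable hr), circleIntegral.integral_congr hr hsplit,
    circleIntegral.integral_sub hint hint', hI, sub_zero, circleIntegral.integral_smul]

theorem circleIntegral_resolvent_eq_of_le {a : A} {c : ℂ} {r R : ℝ} (hr : 0 < r) (hle : r ≤ R)
    (h : Metric.closedBall c R ∩ spectrum ℂ a ⊆ {c}) :
    (∮ z in C(c, R), resolvent a z) = ∮ z in C(c, r), resolvent a z := by
  have hmem : ∀ z ∈ Metric.closedBall c R, z ≠ c → z ∈ resolventSet ℂ a := fun z hz hne => by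
    by_contra hs
    exact hne (h ⟨hz, hs⟩)
  refine Complex.circleIntegral_eq_of_differentiable_on_annulus_off_countable hr hle
    Set.countable_empty ((continuousOn_resolvent a).mono fun z hz => hmem z hz.1 ?_) fun z hz =>
    (spectrum.hasDerivAt_resolvent_const_left
      (hmem z (Metric.ball_subset_closedBall hz.1.1) ?_)).differentiableAt
  · rintro rfl
    exact hz.2 (Metric.mem_ball_self hr)
  · rintro rfl
    exact hz.1.2 (Metric.mem_closedBall_self hr.le)

end Resolvent

/-! ### Riesz projections -/

section Riesz

variable {X : Type*} [NormedAddCommGroup X] [NormedSpace ℂ X] [CompleteSpace X]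

/-- A Riesz projection may be computed on any sufficiently small circle. -/
theorem IsRieszProjection.exists_forall_radius_le {T P : X →L[ℂ] X} {c : ℂ}
    (h : IsRieszProjection T c P) :
    ∃ r : ℝ, 0 < r ∧ ∀ ρ, 0 < ρ → ρ ≤ r → Metric.sphere c ρ ⊆ resolventSet ℂ T ∧
      P = (2 * (Real.pi : ℂ) * Complex.I)⁻¹ • ∮ z in C(c, ρ), resolvent T z := by
  obtain ⟨r, hr, hspec, hP⟩ := h
  refine ⟨r, hr, fun ρ hρ hle => ⟨fun z hz => ?_, ?_⟩⟩
  · by_contra hs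
    have hzc : z = c := hspec ⟨Metric.closedBall_subset_closedBall hle
      (Metric.sphere_subset_closedBall hz), hs⟩
    rw [hzc, Metric.mem_sphere, dist_self] at hz
    exact hρ.ne hz
  · rw [hP, circleIntegral_resolvent_eq_of_le hρ hle hspec]

theorem IsRieszProjection.mul_self {T P : X →L[ℂ] X} {c : ℂ} (h : IsRieszProjection T c P) :
    P * P = P := by
  obtain ⟨r, hr, h⟩ := h.exists_forall_radius_le
  obtain ⟨hs, hP⟩ := h (r / 2) (by positivity) (by linarith)
  obtain ⟨hs', hP'⟩ := h r hr le_rfl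
  have hzero : ∀ w ∈ Metric.sphere c r, w ∉ Metric.closedBall c (r / 2) := by
    intro w hw hw'
    rw [Metric.mem_sphere] at hw
    rw [Metric.mem_closedBall] at hw'
    linarith
  have key := circleIntegral_resolvent_mul_circleIntegral_resolvent (α := 2 * Real.pi * Complex.I)
    (by positivity) hr.le hs hs'
    (Set.disjoint_left.2 fun z hz hz' => hzero z hz' (Metric.sphere_subset_closedBall hz))
    (fun z hz => circleIntegral.integral_sub_inv_of_mem_ball <| by
      rw [Metric.mem_sphere] at hz; rw [Metric.mem_ball]; linarith)
    (fun w hw => circleIntegral_sub_inv_of_notMem_closedBall (by positivity) (hzero w hw))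
  have hpi : (2 * (Real.pi : ℂ) * Complex.I) ≠ 0 := Complex.two_pi_I_ne_zero
  calc P * P = ((2 * (Real.pi : ℂ) * Complex.I)⁻¹ • ∮ z in C(c, r / 2), resolvent T z) *
        ((2 * (Real.pi : ℂ) * Complex.I)⁻¹ • ∮ w in C(c, r), resolvent T w) := by
        rw [← hP, ← hP']
    _ = P := by rw [smul_mul_smul_comm, key, smul_smul, mul_assoc, inv_mul_cancel₀ hpi, mul_one, hP]

theorem IsRieszProjection.mul_eq_zero {T P P' : X →L[ℂ] X} {c c' : ℂ}
    (h : IsRieszProjection T c P) (h' : IsRieszProjection T c' P') (hne : c ≠ c') :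
    P * P' = 0 := by
  obtain ⟨r, hr, h⟩ := h.exists_forall_radius_le
  obtain ⟨r', hr', h'⟩ := h'.exists_forall_radius_le
  have hd : 0 < dist c c' := dist_pos.2 hne
  have hρ : 0 < min (min r r') (dist c c' / 3) := by positivity
  set ρ := min (min r r') (dist c c' / 3)
  have hρd : ρ ≤ dist c c' / 3 := min_le_right _ _
  obtain ⟨hs, hP⟩ := h ρ hρ ((min_le_left _ _).trans (min_le_left _ _))
  obtain ⟨hs', hP'⟩ := h' ρ hρ ((min_le_left _ _).trans (min_le_right _ _))
  have hdisj : Disjoint (Metric.closedBall c ρ) (Metric.closedBall c' ρ) :=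
    Metric.closedBall_disjoint_closedBall (by linarith)
  have key := circleIntegral_resolvent_mul_circleIntegral_resolvent (α := 0) hρ.le hρ.le hs hs'
    (hdisj.mono Metric.sphere_subset_closedBall Metric.sphere_subset_closedBall)
    (fun z hz => circleIntegral_sub_inv_of_notMem_closedBall hρ.le
      (Set.disjoint_left.1 hdisj (Metric.sphere_subset_closedBall hz)))
    (fun w hw => circleIntegral_sub_inv_of_notMem_closedBall hρ.le
      (Set.disjoint_right.1 hdisj (Metric.sphere_subset_closedBall hw)))
  rw [hP, hP', smul_mul_smul_comm, key, zero_smul, smul_zero]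

end Riesz

/-! ### Polynomials of bounded variation approximating the indicator of the nonzero reals -/

open Polynomial in
/-- The polynomial `1 - (1 - z ^ 2 / M ^ 2) ^ n`. It vanishes at `0`, and on `[-M, M]` it takes values
in `[0, 1]`, decreases up to `0`, increases from there on, and tends to `1` away from `0` as
`n → ∞`. -/
noncomputable def cutoffPolynomial (M : ℝ) (n : ℕ) : Polynomial ℂ :=
  1 - (1 - C ((M : ℂ) ^ 2)⁻¹ * X ^ 2) ^ n

theorem eval_cutoffPolynomial (M : ℝ) (n : ℕ) (z : ℂ) :
    (cutoffPolynomial M n).eval z = 1 - (1 - z ^ 2 / (M : ℂ) ^ 2) ^ n := by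
  simp [cutoffPolynomial, div_eq_inv_mul]

/-- The variation is at most `1` on each of `[-M, 0]` and `[0, M]`, by monotonicity. -/
theorem integral_norm_derivative_cutoffPolynomial_le {M a b : ℝ} (hM : 0 < M) (ha : -M ≤ a)
    (hab : a ≤ b) (hb : b ≤ M) (n : ℕ) :
    ∫ t in a..b, ‖(cutoffPolynomial M n).derivative.eval (t : ℂ)‖ ≤ 2 := by
  set g : ℝ → ℝ := fun t => 1 - (1 - t ^ 2 / M ^ 2) ^ n with hg
  set g' : ℝ → ℝ := fun t => n * (1 - t ^ 2 / M ^ 2) ^ (n - 1) * (2 * t / M ^ 2) with hg'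
  have hder : ∀ t, HasDerivAt g (g' t) t := by
    intro t
    have h1 : HasDerivAt (fun t : ℝ => 1 - t ^ 2 / M ^ 2) (-(2 * t / M ^ 2)) t := by
      simpa using ((hasDerivAt_pow 2 t).div_const (M ^ 2)).const_sub 1
    refine ((h1.pow n).const_sub 1).congr_deriv ?_
    simp only [hg']; ring
  have hcont : Continuous g' := by fun_prop
  have heval : ∀ t : ℝ, (cutoffPolynomial M n).derivative.eval (t : ℂ) = (g' t : ℂ) := by
    intro t
    simp [cutoffPolynomial, hg', Polynomial.derivative_pow]
    ring
  have hbase : ∀ t, -M ≤ t → t ≤ M → 0 ≤ 1 - t ^ 2 / M ^ 2 := by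
    intro t h1 h2
    rw [sub_nonneg, div_le_one (by positivity)]
    exact sq_le_sq' h1 h2
  have hnorm : ∀ t : ℝ, ‖(cutoffPolynomial M n).derivative.eval (t : ℂ)‖ = |g' t| := by
    intro t; rw [heval, Complex.norm_real, Real.norm_eq_abs]
  have hii : ∀ u v : ℝ, IntervalIntegrable (fun t => |g' t|) MeasureTheory.volume u v :=
    fun u v => hcont.abs.intervalIntegrable u v
  have hle1 : ∀ t, -M ≤ t → t ≤ M → g t ≤ 1 := fun t h1 h2 => by
    simpa [hg] using pow_nonneg (hbase t h1 h2) n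
  have hpos : ∫ t in (0 : ℝ)..M, |g' t| ≤ 1 := by
    have : ∫ t in (0 : ℝ)..M, |g' t| = ∫ t in (0 : ℝ)..M, g' t := by
      refine intervalIntegral.integral_congr fun t ht => abs_of_nonneg ?_
      rw [Set.uIcc_of_le hM.le] at ht
      have := hbase t (by linarith [ht.1]) ht.2
      have := ht.1
      simp only [hg']
      positivity
    rw [this, intervalIntegral.integral_eq_sub_of_hasDerivAt (fun t _ => hder t)
      (hcont.intervalIntegrable _ _)]
    have := hle1 M (by linarith) le_rfl
    have h0 : g 0 = 0 := by simp [hg]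
    linarith
  have hneg : ∫ t in (-M)..0, |g' t| ≤ 1 := by
    have : ∫ t in (-M)..0, |g' t| = ∫ t in (-M)..0, -g' t := by
      refine intervalIntegral.integral_congr fun t ht => abs_of_nonpos ?_
      rw [Set.uIcc_of_le (by linarith)] at ht
      have := hbase t ht.1 (by linarith [ht.2])
      refine mul_nonpos_of_nonneg_of_nonpos (by positivity) ?_
      exact div_nonpos_of_nonpos_of_nonneg (by linarith [ht.2]) (by positivity)
    rw [this, intervalIntegral.integral_neg, intervalIntegral.integral_eq_sub_of_hasDerivAt
      (fun t _ => hder t) (hcont.intervalIntegrable _ _)]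
    have := hle1 (-M) le_rfl (by linarith)
    have h0 : g 0 = 0 := by simp [hg]
    linarith
  calc ∫ t in a..b, ‖(cutoffPolynomial M n).derivative.eval (t : ℂ)‖
      = ∫ t in a..b, |g' t| := by simp only [hnorm]
    _ ≤ ∫ t in (-M)..M, |g' t| :=
        intervalIntegral.integral_mono_interval ha hab hb
          (Eventually.of_forall fun t => abs_nonneg _) (hii _ _)
    _ = (∫ t in (-M)..0, |g' t|) + ∫ t in (0 : ℝ)..M, |g' t| :=
        (intervalIntegral.integral_add_adjacent_intervals (hii _ _) (hii _ _)).symm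
    _ ≤ 2 := by linarith

theorem IsWellBounded.exists_norm_aeval_cutoffPolynomial_le {X : Type*} [NormedAddCommGroup X]
    [NormedSpace ℂ X] {T : X →L[ℂ] X} (hT : IsWellBounded T) :
    ∃ M₀ B : ℝ, 0 < M₀ ∧ ∀ M, M₀ ≤ M → ∀ n,
      ‖Polynomial.aeval T (cutoffPolynomial M n)‖ ≤ B := by
  obtain ⟨a, b, K, hab, h⟩ := hT
  refine ⟨|a| + |b| + 1, |K| * 3, by positivity, fun M hM n => (h _).trans ?_⟩
  have ha0 := abs_nonneg a
  have hb0 := abs_nonneg b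
  have ha : -M ≤ a := by linarith [neg_abs_le a]
  have hb : b ≤ M := by linarith [le_abs_self b]
  have hb' : -M ≤ b := ha.trans hab
  have hM0 : 0 < M := by linarith
  have hint := integral_norm_derivative_cutoffPolynomial_le hM0 ha hab hb n
  have hint0 : 0 ≤ ∫ t in a..b, ‖(cutoffPolynomial M n).derivative.eval (t : ℂ)‖ :=
    intervalIntegral.integral_nonneg hab fun t _ => norm_nonneg _
  have hend : ‖(cutoffPolynomial M n).eval (b : ℂ)‖ ≤ 1 := by
    have h0 : 0 ≤ 1 - b ^ 2 / M ^ 2 := by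
      rw [sub_nonneg, div_le_one (by positivity)]
      exact sq_le_sq' hb' hb
    have h1 : 1 - b ^ 2 / M ^ 2 ≤ 1 := by
      have : 0 ≤ b ^ 2 / M ^ 2 := by positivity
      linarith
    have heq : (cutoffPolynomial M n).eval (b : ℂ) = ((1 - (1 - b ^ 2 / M ^ 2) ^ n : ℝ) : ℂ) := by
      rw [eval_cutoffPolynomial]; push_cast; rfl
    rw [heq, Complex.norm_real, Real.norm_eq_abs, abs_of_nonneg (sub_nonneg.2 (pow_le_one₀ h0 h1))]
    linarith [pow_nonneg h0 n]
  calc _ ≤ |K| * _ := mul_le_mul_of_nonneg_right (le_abs_self K) (by positivity)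
    _ ≤ |K| * 3 := mul_le_mul_of_nonneg_left (by linarith) (abs_nonneg K)

/-- The hypothesis says `‖z‖ ^ 4 ≤ 2 * M ^ 2 * re (z ^ 2)`. As this forces `re (z ^ 2) > 0`, the
inequality becomes strict on doubling `M`. This replaces a proof that the eigenvalues of a
well-bounded operator are real. -/
theorem norm_one_sub_sq_div_lt_one {z : ℂ} (hz : z ≠ 0) {M : ℝ} (hM : 0 < M)
    (h : ‖1 - z ^ 2 / (M : ℂ) ^ 2‖ ≤ 1) : ‖1 - z ^ 2 / ((2 * M : ℝ) : ℂ) ^ 2‖ < 1 := by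
  have key : ∀ w : ℂ, w ≠ 0 → ‖1 - w‖ ≤ 1 → ‖1 - w / 4‖ < 1 := by
    intro w hw h1
    have hpos := Complex.normSq_pos.2 hw
    have h2 : Complex.normSq (1 - w) ≤ 1 := by
      rw [Complex.normSq_eq_norm_sq]; exact pow_le_one₀ (norm_nonneg _) h1
    have h3 : Complex.normSq (1 - w / 4) < 1 := by
      have e : w / 4 = ((1 / 4 : ℝ) : ℂ) * w := by push_cast; ring
      rw [e]
      simp only [Complex.normSq_apply, Complex.sub_re, Complex.sub_im, Complex.one_re,
        Complex.one_im, Complex.re_ofReal_mul, Complex.im_ofReal_mul] at h2 hpos ⊢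
      nlinarith
    rw [Complex.normSq_eq_norm_sq] at h3
    exact (sq_lt_one_iff₀ (norm_nonneg _)).1 h3
  have hM' : (M : ℂ) ≠ 0 := by exact_mod_cast hM.ne'
  have := key (z ^ 2 / (M : ℂ) ^ 2) (by positivity) h
  convert this using 3
  push_cast
  field_simp
  norm_num

theorem norm_le_one_of_norm_pow_le {z : ℂ} {B : ℝ} (h : ∀ n : ℕ, ‖z ^ n‖ ≤ B) : ‖z‖ ≤ 1 := by
  by_contra! hz
  obtain ⟨n, hn⟩ := pow_unbounded_of_one_lt B hz
  have := h n
  rw [norm_pow] at this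
  linarith

theorem aeval_mul_eq_eval_smul {A : Type*} [Ring A] [Algebra ℂ A] {a b : A} {c : ℂ}
    (h : a * b = c • b) (p : Polynomial ℂ) : Polynomial.aeval a p * b = p.eval c • b := by
  induction p using Polynomial.induction_on' with
  | add p q hp hq => simp [add_mul, add_smul, hp, hq]
  | monomial n r =>
    have hpow : a ^ n * b = c ^ n • b := by
      induction n with
      | zero => simp
      | succ n ih => rw [pow_succ, mul_assoc, h, mul_smul_comm, ih, smul_smul, pow_succ']
    rw [Polynomial.aeval_monomial, mul_assoc, hpow, Polynomial.eval_monomial,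
      Algebra.algebraMap_eq_smul_one, smul_mul_assoc, one_mul, smul_smul]

/-! ### Rearranged sum representations -/

/-- A convergent, possibly rearranged, series of multiples of mutually annihilating idempotents has
the expected product with each idempotent. Nothing is assumed about `P j` where `μ j = 0`. -/
theorem mul_eq_smul_of_tendsto_sum {A : Type*} [NormedRing A] [NormedAlgebra ℂ A] {S : A}
    {μ : ℕ → ℂ} {P : ℕ → A} (hidem : ∀ j, μ j ≠ 0 → P j * P j = P j)
    (horth : ∀ i j, i ≠ j → μ i ≠ 0 → μ j ≠ 0 → P i * P j = 0)
    (π : Equiv.Perm ℕ)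
    (hS : Tendsto (fun n => ∑ j ∈ Finset.range n, μ (π j) • P (π j)) atTop (𝓝 S))
    (k : ℕ) (hk : μ k ≠ 0) : S * P k = μ k • P k ∧ P k * S = μ k • P k := by
  have hterm : ∀ j, (μ (π j) • P (π j)) * P k = if j = π.symm k then μ k • P k else 0 := by
    intro j
    split_ifs with hj
    · rw [hj, Equiv.apply_symm_apply, smul_mul_assoc, hidem k hk]
    · have hne : π j ≠ k := fun h => hj (by rw [← h, Equiv.symm_apply_apply])
      by_cases h0 : μ (π j) = 0
      · rw [h0, zero_smul, zero_mul]
      · rw [smul_mul_assoc, horth _ _ hne h0 hk, smul_zero]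
  have hterm' : ∀ j, P k * (μ (π j) • P (π j)) = if j = π.symm k then μ k • P k else 0 := by
    intro j
    split_ifs with hj
    · rw [hj, Equiv.apply_symm_apply, mul_smul_comm, hidem k hk]
    · have hne : π j ≠ k := fun h => hj (by rw [← h, Equiv.symm_apply_apply])
      by_cases h0 : μ (π j) = 0
      · rw [h0, zero_smul, mul_zero]
      · rw [mul_smul_comm, horth _ _ hne.symm hk h0, smul_zero]
  constructor
  · refine tendsto_nhds_unique (hS.mul_const (P k)) (tendsto_const_nhds.congr' ?_)
    filter_upwards [eventually_gt_atTop (π.symm k)] with n hn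
    rw [Finset.sum_mul, Finset.sum_congr rfl fun j _ => hterm j, Finset.sum_ite_eq',
      if_pos (Finset.mem_range.2 hn)]
  · refine tendsto_nhds_unique (hS.const_mul (P k)) (tendsto_const_nhds.congr' ?_)
    filter_upwards [eventually_gt_atTop (π.symm k)] with n hn
    rw [Finset.mul_sum, Finset.sum_congr rfl fun j _ => hterm' j, Finset.sum_ite_eq',
      if_pos (Finset.mem_range.2 hn)]

theorem mem_closure_span_of_tendsto_sum {A : Type*} [NormedRing A] [NormedAlgebra ℂ A] {S : A}
    {μ : ℕ → ℂ} {P : ℕ → A} (π : Equiv.Perm ℕ)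
    (hS : Tendsto (fun n => ∑ j ∈ Finset.range n, μ (π j) • P (π j)) atTop (𝓝 S)) :
    S ∈ (Submodule.span ℂ {x | ∃ j, μ j ≠ 0 ∧ P j = x}).topologicalClosure := by
  refine mem_closure_of_tendsto hS (Eventually.of_forall fun n => Submodule.sum_mem _ fun j _ => ?_)
  by_cases hj : μ (π j) = 0
  · rw [hj, zero_smul]; exact Submodule.zero_mem _
  · exact Submodule.smul_mem _ _ (Submodule.subset_span ⟨π j, hj, rfl⟩)

/-- A bounded sequence of left multipliers that is an approximate unit on a set is one on its closed
span. -/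
theorem tendsto_mul_of_mem_closure_span {A : Type*} [NormedRing A] [NormedAlgebra ℂ A]
    {R : ℕ → A} {B : ℝ} (hB : ∀ n, ‖R n‖ ≤ B) {s : Set A}
    (hs : ∀ x ∈ s, Tendsto (fun n => R n * x) atTop (𝓝 x)) {x : A}
    (hx : x ∈ (Submodule.span ℂ s).topologicalClosure) :
    Tendsto (fun n => R n * x) atTop (𝓝 x) := by
  have hspan : ∀ y ∈ Submodule.span ℂ s, Tendsto (fun n => R n * y) atTop (𝓝 y) := by
    intro y hy
    induction hy using Submodule.span_induction with
    | mem y hy => exact hs y hy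
    | zero => simp
    | add y z _ _ h1 h2 => simpa only [mul_add] using h1.add h2
    | smul c y _ h => simpa only [mul_smul_comm] using h.const_smul c
  have hB0 : 0 ≤ B := (norm_nonneg _).trans (hB 0)
  rw [Metric.tendsto_atTop]
  intro ε hε
  obtain ⟨y, hy, hxy⟩ := Metric.mem_closure_iff.1 hx (ε / (2 * (B + 1))) (by positivity)
  obtain ⟨N, hN⟩ := Metric.tendsto_atTop.1 (hspan y hy) (ε / 2) (by positivity)
  refine ⟨N, fun n hn => ?_⟩
  have h1 := hN n hn
  rw [dist_eq_norm] at h1 hxy ⊢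
  have hsplit : R n * x - x = R n * (x - y) + (R n * y - y) - (x - y) := by noncomm_ring
  have h2 : ‖R n * (x - y)‖ ≤ B * ‖x - y‖ :=
    (norm_mul_le _ _).trans (mul_le_mul_of_nonneg_right (hB n) (norm_nonneg _))
  have h3 : (B + 1) * ‖x - y‖ < ε / 2 := by
    rw [lt_div_iff₀ (by positivity)] at hxy
    linarith
  rw [hsplit]
  have h4 := norm_sub_le (R n * (x - y) + (R n * y - y)) (x - y)
  have h5 := norm_add_le (R n * (x - y)) (R n * y - y)
  linarith

theorem mainTheorem3 {X : Type*} [NormedAddCommGroup X] [NormedSpace ℂ X] [CompleteSpace X]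
    (T : X →L[ℂ] X) (hcompact : IsCompactOperator T) (hwb : IsWellBounded T)
    (μ : ℕ → ℂ) (P : ℕ → X →L[ℂ] X) (hrep : IsSumRepresentation T μ P)
    (π : Equiv.Perm ℕ)
    (hconv : ∃ S : X →L[ℂ] X,
      Tendsto (fun n => ∑ j ∈ Finset.range n, μ (π j) • P (π j)) atTop (𝓝 S)) :
    Tendsto (fun n => ∑ j ∈ Finset.range n, μ (π j) • P (π j)) atTop (𝓝 T) := by
  obtain ⟨S, hS⟩ := hconv
  have hidem : ∀ j, μ j ≠ 0 → P j * P j = P j := fun j hj => (hrep.isRieszProjection j hj).mul_self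
  have horth : ∀ i j, i ≠ j → μ i ≠ 0 → μ j ≠ 0 → P i * P j = 0 := fun i j hij hi hj =>
    (hrep.isRieszProjection i hi).mul_eq_zero (hrep.isRieszProjection j hj)
      fun h => hij (hrep.distinct i j hi h)
  have hTP := mul_eq_smul_of_tendsto_sum hidem horth (Equiv.refl ℕ) hrep.tendsto
  have hSP := mul_eq_smul_of_tendsto_sum hidem horth π hS
  have hPD : ∀ j, μ j ≠ 0 → P j * (T - S) = 0 := fun j hj => by
    rw [mul_sub, (hTP j hj).2, (hSP j hj).2, sub_self]
  have hTD : T * (T - S) = 0 := by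
    refine tendsto_nhds_unique (hrep.tendsto.mul_const (T - S))
      (tendsto_const_nhds.congr fun n => ?_)
    rw [Finset.sum_mul]
    refine (Finset.sum_eq_zero fun j _ => ?_).symm
    rw [smul_mul_assoc]
    by_cases hj : μ j = 0
    · rw [hj, zero_smul]
    · rw [hPD j hj, smul_zero]
  obtain ⟨M, B, hM, hB⟩ := hwb.exists_norm_aeval_cutoffPolynomial_le
  have hRP : ∀ x ∈ {x | ∃ j, μ j ≠ 0 ∧ P j = x},
      Tendsto (fun n => Polynomial.aeval T (cutoffPolynomial (2 * M) n) * x) atTop (𝓝 x) := by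
    rintro _ ⟨j, hj, rfl⟩
    by_cases hP0 : P j = 0
    · simp [hP0]
    -- `p(T) * P j = p(μ j) • P j` turns the bound on `p(T)` into one on the powers of
    -- `1 - μ j ^ 2 / M ^ 2`.
    have hle : ‖1 - μ j ^ 2 / (M : ℂ) ^ 2‖ ≤ 1 := by
      refine norm_le_one_of_norm_pow_le (B := 1 + B) fun n => ?_
      have h1 : ‖(cutoffPolynomial M n).eval (μ j)‖ ≤ B := by
        refine le_of_mul_le_mul_right ?_ (norm_pos_iff.2 hP0)
        rw [← norm_smul, ← aeval_mul_eq_eval_smul (hTP j hj).1]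
        exact (norm_mul_le _ _).trans
          (mul_le_mul_of_nonneg_right (hB M le_rfl n) (norm_nonneg _))
      have h2 : (1 - μ j ^ 2 / (M : ℂ) ^ 2) ^ n = 1 - (cutoffPolynomial M n).eval (μ j) := by
        rw [eval_cutoffPolynomial, sub_sub_cancel]
      rw [h2]
      exact (norm_sub_le _ _).trans (by rw [norm_one]; linarith)
    have hpow := tendsto_pow_atTop_nhds_zero_of_norm_lt_one (norm_one_sub_sq_div_lt_one hj hM hle)
    have hlim := (hpow.const_sub 1).smul_const (P j)
    rw [sub_zero, one_smul] at hlim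
    refine hlim.congr fun n => ?_
    rw [aeval_mul_eq_eval_smul (hTP j hj).1, eval_cutoffPolynomial]
  have hRD : ∀ n, Polynomial.aeval T (cutoffPolynomial (2 * M) n) * (T - S) = 0 := fun n => by
    rw [aeval_mul_eq_eval_smul (c := 0) (by rw [hTD, zero_smul]), eval_cutoffPolynomial]
    simp
  have hmem := Submodule.sub_mem _ (mem_closure_span_of_tendsto_sum (Equiv.refl ℕ) hrep.tendsto)
    (mem_closure_span_of_tendsto_sum π hS)
  have hlim := tendsto_mul_of_mem_closure_span (fun n => hB (2 * M) (by linarith) n) hRP hmem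
  simp only [hRD] at hlim
  have hTS : T - S = 0 := tendsto_nhds_unique hlim tendsto_const_nhds
  rwa [sub_eq_zero.1 hTS]
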